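/- Let $F:\mathbf{Set}\to\mathbf{Set}$ be a finitary functor (one preserving filtered colimits), let $Y$ be a nonempty set, and choose $p\in Y$. Conventions. A presentation of $F$ is a finitary signature $\Sigma$ with a natural transformation $\varepsilon:H_\Sigma\to F$ with surjective components, where $H_\Sigma Z=\coprod_{\sigma\in\Sigma}Z^{\mathrm{ar}(\sigma)}$; then $\varepsilon+\mathrm{id}:H_{\Sigma+Y}=H_\Sigma(-)+Y\to F(-)+Y$ is a presentation of $F(-)+Y$ (elements of $Y$ being nullary symbols). Let $\Phi Y$ be the initial algebra of $F(-)+Y$ (the free $F$-algebra on $Y$), with structure $[\varphi,\eta]:F(\Phi Y)+Y\to\Phi Y$, and let $\Psi Y$ be the terminal coalgebra of $F(-)+Y$ (the free completely iterative $F$-algebra on $Y$), with structure $\tau$ and with the $F$-algebra structure $\psi=\tau^{-1}\cdot\mathrm{inl}$. Let $m:\Phi Y\to\Psi Y$ be the unique homomorphism of $(F(-)+Y)$-coalgebras from $(\Phi Y,[\varphi,\eta]^{-1})$ to $(\Psi Y,\tau)$. Order by cutting. For a (possibly infinite) $(\Sigma+Y)$-tree $s$ let $\partial'_n s$ be the finite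 tree obtained by deleting all nodes of height $>n$ and relabelling all nodes of height $n$ by $p$. Let $\sim$ be the congruence on finite $(\Sigma+Y)$-trees generated by the substitution instances of the equations between flat terms that are merged by $\varepsilon+\mathrm{id}$, and put $s\sim^* s'$ iff $\partial'_n s\sim\partial'_n s'$ for all $n\in\mathbb N$. Let $s\mapsto[s]$ be the unique $(F(-)+Y)$-coalgebra homomorphism from the coalgebra of all $(\Sigma+Y)$-trees (tree-tupling followed by $\varepsilon+\mathrm{id}$) to $\Psi Y$. For $x,y\in\Psi Y$ put $x\sqsubseteq y$ iff $x=y$, or $x=[s]$, $y=[s']$ for some trees with $s\sim^*\partial'_n s'$ for some $n\in\mathbb N$. Approximate solutions. Define $\partial_n:\Psi Y\to\Phi Y$ by $\partial_0=\mathrm{const}_{\eta(p)}$ and $\partial_{n+1}=[\varphi,\eta]\cdot(F\partial_n+\mathrm{id}_Y)\cdot\tau$. For a recursive equation $e:X\to FX+\Psi Y$ ($X$ any set) put $$e_0^\dagger=\mathrm{const}_{\eta(p)},\qquad e^\dagger_{k+1}=[\varphi,\mathrm{id}]\cdot(Fe^\dagger_k+\mathrm{id})\cdot(\mathrm{id}+\partial_{k+1})\cdot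 e:\;X\to\Phi Y .$$ A solution of $e$ is a map $e^\dagger:X\to\Psi Y$ with $e^\dagger=[\psi,\mathrm{id}]\cdot(Fe^\dagger+\mathrm{id})\cdot e$. Theorem. A presentation of $F$, an initial algebra $\Phi Y$ and a terminal coalgebra $\Psi Y$ of $F(-)+Y$ exist. For every choice of them, $\sqsubseteq$ is a partial order on $\Psi Y$, and $m$ is injective, so that $\Phi Y$ is a subposet of $\Psi Y$ via $m$. For every set $X$ and every recursive equation $e:X\to FX+\Psi Y$, in the poset $(\Psi Y)^X$ ordered pointwise: 1. $e^\dagger_0$ is the least element of $(\Phi Y)^X$, and $m\cdot e^\dagger_0\sqsubseteq m\cdot e^\dagger_1\sqsubseteq m\cdot e^\dagger_2\sqsubseteq\cdots$ is an $\omega$-chain; 2. $e$ has a unique solution $e^\dagger:X\to\Psi Y$, and $e^\dagger=\bigsqcup_{k\in\mathbb N}m\cdot e^\dagger_k$. -/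

import Mathlib

open CategoryTheory CategoryTheory.Limits CategoryTheory.Endofunctor

universe u

namespace FreeCIA

noncomputable section

/-! ### Signatures, polynomial functors and trees -/

/-- A finitary signature: a set of operation symbols, each with a finite arity. -/
structure Signature : Type (u + 1) where
  /-- the operation symbols -/
  ops : Type u
  /-- the arity of a symbol -/
  arity : ops → ℕ

namespace Signature

variable (S : Signature.{u})

/-- The polynomial functor of `S` in Mathlib's unbundled form; an element of `S.poly Z` is a flat
term `σ(z₁, …, zₙ)`. -/
abbrev poly : PFunctor.{u, 0} := ⟨S.ops, fun s => Fin (S.arity s)⟩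

/-- The polynomial set functor `H_S Z = ∐ σ, Z ^ (arity σ)`. -/
def functor : Type u ⥤ Type u where
  obj Z := S.poly Z
  map f := ↾(S.poly.map f)

/-- All (finite and infinite) `S`-trees, the terminal coalgebra of `H_S`. -/
abbrev Tree : Type u := S.poly.M

/-- The finite `S`-trees, the initial algebra of `H_S`. -/
abbrev FinTree : Type u := S.poly.W

variable {S}

/-- A finite tree considered as a tree. -/
def FinTree.toTree : S.FinTree → S.Tree
  | WType.mk s f => PFunctor.M.mk ⟨s, fun i => FinTree.toTree (f i)⟩

/-- The root-only tree labelled by a nullary symbol `q`. -/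
def leaf (q : S.ops) (hq : S.arity q = 0) : S.FinTree :=
  PFunctor.W.mk ⟨q, fun i => Fin.elim0 (Fin.cast hq i)⟩

/-- The cutting of a tree at height `n`: all nodes of height larger than `n` are deleted, and
all nodes of height `n` become leaves labelled by the nullary symbol `q`. -/
def cut (q : S.ops) (hq : S.arity q = 0) : ℕ → S.Tree → S.FinTree
  | 0, _ => leaf q hq
  | n + 1, t => PFunctor.W.mk ⟨t.head, fun i => cut q hq n (t.children i)⟩

/-- The signature `S + Y`, where the elements of `Y` have arity `0`. -/
def addVars (S : Signature.{u}) (Y : Type u) : Signature.{u} where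
  ops := S.ops ⊕ Y
  arity := Sum.elim S.arity (fun _ => 0)

end Signature

/-! ### Presentations and the order by cutting -/

/-- A presentation of a set functor `G`: a finitary signature and a natural transformation
`H_S ⟶ G` with epic components. -/
structure Presentation (G : Type u ⥤ Type u) where
  /-- the signature -/
  sig : Signature.{u}
  /-- the natural transformation -/
  ε : sig.functor ⟶ G
  /-- its components are epic -/
  epi : ∀ Z : Type u, Epi (ε.app Z)

namespace Presentation

variable {G : Type u ⥤ Type u} (P : Presentation G)

/-- The congruence on finite trees generated by the `ε`-equations, i.e. by the
equations `a = b` between flat terms over a set `Z` of variables with `ε_Z a = ε_Z b`, where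
arbitrary finite trees may be substituted for the variables. -/
inductive Cong : P.sig.FinTree → P.sig.FinTree → Prop
  | eqn {Z : Type u} (a b : P.sig.functor.obj Z) (h : P.ε.app Z a = P.ε.app Z b)
      (θ : Z → P.sig.FinTree) :
      Cong (PFunctor.W.mk (P.sig.functor.map (↾θ) a)) (PFunctor.W.mk (P.sig.functor.map (↾θ) b))
  | op (s : P.sig.ops) (f g : Fin (P.sig.arity s) → P.sig.FinTree) (h : ∀ i, Cong (f i) (g i)) :
      Cong (PFunctor.W.mk ⟨s, f⟩) (PFunctor.W.mk ⟨s, g⟩)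
  | refl (t : P.sig.FinTree) : Cong t t
  | symm {t t' : P.sig.FinTree} (h : Cong t t') : Cong t' t
  | trans {t t' t'' : P.sig.FinTree} (h : Cong t t') (h' : Cong t' t'') : Cong t t''

/-- The congruence on all trees of a possibly infinite application of `ε`-equations. -/
def CongStar (q : P.sig.ops) (hq : P.sig.arity q = 0) (s s' : P.sig.Tree) : Prop :=
  ∀ n : ℕ, P.Cong (Signature.cut q hq n s) (Signature.cut q hq n s')

/-- The set of all trees as a coalgebra for `G`. -/
def treeCoalgebra : Coalgebra G where
  V := P.sig.Tree
  str := ↾(fun t : P.sig.Tree => P.ε.app P.sig.Tree (PFunctor.M.dest t))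

/-- The canonical map `s ↦ [s]` from trees to the terminal coalgebra `T` of `G`: the unique
homomorphism of `G`-coalgebras. -/
def classOf {T : Coalgebra G} (hT : IsTerminal T) (s : P.sig.Tree) : T.V :=
  (hT.from P.treeCoalgebra).f s

/-- The order by cutting on the terminal coalgebra of `G`, for a chosen nullary symbol `q`:
`[s] < [s']` for distinct classes iff `s` is congruent to some cutting of `s'`. -/
def CutLE (q : P.sig.ops) (hq : P.sig.arity q = 0) {T : Coalgebra G} (hT : IsTerminal T)
    (x y : T.V) : Prop :=
  x = y ∨ ∃ s s' : P.sig.Tree, P.classOf hT s = x ∧ P.classOf hT s' = y ∧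
    ∃ n : ℕ, P.CongStar q hq s (Signature.FinTree.toTree (Signature.cut q hq n s'))

end Presentation

/-! ### The functor `F(-) + Y`, its initial algebra and its terminal coalgebra -/

/-- The set functor `F(-) + Y`. -/
def plus (F : Type u ⥤ Type u) (Y : Type u) : Type u ⥤ Type u where
  obj Z := F.obj Z ⊕ Y
  map f := ↾(Sum.map (F.map f) id)
  map_id Z := by ext x; cases x <;> simp
  map_comp f g := by ext x; cases x <;> simp

/-- The component at `Z` of `ε + id : H_{S+Y} ⟶ F(-) + Y`. -/
def plusFun {F : Type u ⥤ Type u} (P : Presentation F) (Y : Type u) (Z : Type u) :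
    (P.sig.addVars Y).functor.obj Z → (plus F Y).obj Z
  | ⟨Sum.inl s, f⟩ => Sum.inl (P.ε.app Z (⟨s, f⟩ : P.sig.poly Z))
  | ⟨Sum.inr y, _⟩ => Sum.inr y

/-- The presentation `ε + id` of `F(-) + Y` by the signature `S + Y`. -/
def Presentation.plus {F : Type u ⥤ Type u} (P : Presentation F) (Y : Type u) :
    Presentation (plus F Y) where
  sig := P.sig.addVars Y
  ε :=
    { app := fun Z => ↾(plusFun P Y Z)
      naturality := by
        intro Z Z' f
        ext ⟨s | y, g⟩
        · exact congrArg Sum.inl (NatTrans.naturality_apply P.ε f (⟨s, g⟩ : P.sig.poly Z))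
        · rfl }
  epi := by
    intro Z
    rw [epi_iff_surjective]
    rintro (z | y)
    · obtain ⟨⟨s, f⟩, h⟩ := (epi_iff_surjective _).1 (P.epi Z) z
      exact ⟨⟨Sum.inl s, f⟩, congrArg Sum.inl h⟩
    · exact ⟨⟨Sum.inr y, fun i => Fin.elim0 i⟩, rfl⟩

section

variable {F : Type u ⥤ Type u} {Y : Type u}

/-- The order by cutting on `ΨY`, the terminal coalgebra of `F(-) + Y`, with respect to the
presentation `ε + id` and the chosen point `p ∈ Y`. -/
def psiLE (P : Presentation F) (p : Y) {Psi : Coalgebra (plus F Y)} (hPsi : IsTerminal Psi)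
    (x y : Psi.V) : Prop :=
  (P.plus Y).CutLE (Sum.inr p : P.sig.ops ⊕ Y) rfl hPsi x y

/-- The structure of an `F`-algebra on `ΨY`: the first component of the inverse of
`ΨY ⟶ F(ΨY) + Y`. -/
abbrev psiAlgebra {Psi : Coalgebra (plus F Y)} (hPsi : IsTerminal Psi) : Algebra F where
  a := Psi.V
  str := ↾(fun z : F.obj Psi.V =>
    Coalgebra.Terminal.strInv hPsi (Sum.inl z : F.obj Psi.V ⊕ Y))

/-- The structure of an `F`-algebra on `ΦY`, the initial algebra of `F(-) + Y`. -/
abbrev phiAlgebra (Phi : Algebra (plus F Y)) : Algebra F where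
  a := Phi.a
  str := ↾(fun z : F.obj Phi.a => Phi.str (Sum.inl z : F.obj Phi.a ⊕ Y))

/-- The universal map `η : Y → ΦY`. -/
def phiUnit (Phi : Algebra (plus F Y)) (y : Y) : Phi.a :=
  Phi.str (Sum.inr y : F.obj Phi.a ⊕ Y)

/-- The inclusion `m : ΦY → ΨY`: the unique homomorphism of coalgebras for `F(-) + Y` from `ΦY`
(with the inverted algebra structure) to `ΨY`. -/
def incl {Phi : Algebra (plus F Y)} (hPhi : IsInitial Phi) {Psi : Coalgebra (plus F Y)}
    (hPsi : IsTerminal Psi) (t : Phi.a) : Psi.V :=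
  (hPsi.from (⟨Phi.a, Algebra.Initial.strInv hPhi⟩ : Coalgebra (plus F Y))).f t

/-- The cutting maps `∂ₙ : ΨY → ΦY`. With `G = F(-) + Y`, this is the composite
`ΨY ⟶ Gⁿ 1 ⟶ Gⁿ⁺¹ ∅ ⟶ ΦY` of the projection to the terminal-coalgebra chain, of `Gⁿ p` and of the
colimit map of the initial-algebra chain, unfolded along `n`. -/
def cutting (p : Y) (Psi : Coalgebra (plus F Y)) (Phi : Algebra (plus F Y)) : ℕ → Psi.V → Phi.a
  | 0, _ => phiUnit Phi p
  | n + 1, x => Phi.str ((plus F Y).map (↾(cutting p Psi Phi n)) (Psi.str x))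

end

/-! ### Recursive equations -/

/-- `s` is a solution of the recursive equation `e : X → F X + A` in the `F`-algebra `A`. -/
def IsSolution {F : Type u ⥤ Type u} (A : Algebra F) {X : Type u} (e : X → F.obj X ⊕ A.a)
    (s : X → A.a) : Prop :=
  ∀ x : X, s x = Sum.elim (fun z : F.obj X => A.str (F.map (↾s) z)) id (e x)

/-- The approximate solutions `X → ΦY` of a recursive equation `e : X → F X + ΨY`: the zeroth one
is constant with value `p`, and the `(k+1)`-st one is
`[φ, id] ∘ (F(k-th one) + id) ∘ (id + ∂ₖ₊₁) ∘ e`. -/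
def approx {F : Type u ⥤ Type u} {Y : Type u} (p : Y) (Psi : Coalgebra (plus F Y))
    (Phi : Algebra (plus F Y)) {X : Type u} (e : X → F.obj X ⊕ Psi.V) : ℕ → X → Phi.a
  | 0, _ => phiUnit Phi p
  | k + 1, x =>
      Sum.elim (fun z : F.obj X => (phiAlgebra Phi).str (F.map (↾(approx p Psi Phi e k)) z))
        (cutting p Psi Phi (k + 1)) (e x)

end

end FreeCIA

/-!
Write `G = F(-) + Y`. Everything rests on three facts about the cutting maps `∂ₙ : ΨY → ΦY` and the
inclusion `m : ΦY → ΨY`.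

* Cuttings compose: `∂ₖ ∘ m ∘ ∂ₙ = ∂ₘᵢₙ₍ₖ,ₙ₎` (`cutting_incl_cutting`).
* Elements of `ΦY` have finite height: `∂ₖ (m t) = t` for all large `k`
  (`exists_forall_cutting_incl`). Hence `m` is injective.
* The cuttings separate the elements of `ΨY` (`eq_of_forall_cutting_eq`). This is Worrell's argument
  for finitary functors: an element of `G Q` involves only finitely many elements of `Q`, which are
  already separated at a finite height, so that having the same cuttings is a precongruence.

The class of the tree `s` cut at height `n` is `m (∂ₙ [s])`, and congruent finite trees have equal
values in `ΦY`. By separation, `x ⊑ y` therefore means that `x = y` or `x = m (∂ₙ y)` for some `n`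
(`psiLE_iff`). This makes the axioms of a partial order immediate, and it makes every `y` the
supremum of its cuttings: if all cuttings of `y` are below `u`, then either one cutting of `u`
equals arbitrarily high cuttings of `y`, and so `y` itself, or arbitrarily high cuttings of `y` are
equally high cuttings of `u`, and so `y = u` (`psiLE_of_forall_cutting`).

A recursive equation `e : X → F X + ΨY` makes `X + ΨY` a `G`-coalgebra whose homomorphisms to `ΨY`
correspond to the solutions of `e`, so there is exactly one solution `s`. By induction the `k`-th
approximate solution is `∂ₖ ∘ s` (`IsSolution.approx_eq`), so the claims about approximate solutions
are the claims about cuttings, taken pointwise.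

As to existence, a finitary functor is presented by the elements of its values at finite sets. Given
a presentation, the finite trees modulo equality of values in all algebras form an initial algebra,
and the quotient of the coalgebra of all trees by its largest precongruence is terminal, because
every coalgebra has a homomorphism into the coalgebra of all trees.
-/

namespace FreeCIA

/-! ### Set functors and their presentations -/

section Functors

variable (G : Type u ⥤ Type u)

theorem map_map_apply {A B C : Type u} (f : A → B) (g : B → C) (x : G.obj A) :
    G.map (↾g) (G.map (↾f) x) = G.map (↾(g ∘ f)) x :=
  (ConcreteCategory.congr_hom (G.map_comp (↾f) (↾g)) x).symm

theorem map_id_apply {A : Type u} (x : G.obj A) : G.map (↾(id : A → A)) x = x :=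
  ConcreteCategory.congr_hom (G.map_id A) x

/-- Every element of `G Z` comes from a finite subset of `Z`, provided that `G` is finitary: `Z` is
the filtered colimit of its finite subsets. -/
theorem exists_fin_preimage [PreservesFilteredColimits G] {Z : Type u} (z : G.obj Z) :
    ∃ (n : ℕ) (a : G.obj (ULift.{u} (Fin n))) (f : ULift.{u} (Fin n) → Z), G.map (↾f) a = z := by
  have : IsFiltered (HasCardinalLT.Set Z Cardinal.aleph0.{u}) :=
    HasCardinalLT.Set.isFiltered_of_aleph0_le Z _ le_rfl
  obtain ⟨⟨A, hA⟩, y, hy⟩ := Types.jointly_surjective_of_isColimit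
    (isColimitOfPreserves G (HasCardinalLT.Set.isColimitCocone Z Cardinal.aleph0.{u} le_rfl)) z
  have : Finite A := hasCardinalLT_aleph0_iff _ |>.1 hA
  obtain ⟨n, ⟨k⟩⟩ := Finite.exists_equiv_fin A
  let k' : A ≃ ULift.{u} (Fin n) := k.trans Equiv.ulift.symm
  let y' : G.obj A := y
  refine ⟨n, G.map (↾k') y', Subtype.val ∘ k'.symm, ?_⟩
  have h : (Subtype.val ∘ k'.symm) ∘ k' = (Subtype.val : A → Z) := by ext a; simp
  rw [map_map_apply, h]
  exact hy

/-- A finitary set functor has a presentation: its `n`-ary symbols are the elements of `G n`, and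
`ε` sends the flat term `a(f₀, …, fₙ₋₁)` to `G f a`. -/
theorem nonempty_presentation [PreservesFilteredColimits G] : Nonempty (Presentation G) := by
  refine ⟨⟨⟨Σ n : ℕ, G.obj (ULift.{u} (Fin n)), fun a => a.1⟩,
    { app := fun Z => ↾fun t => G.map (↾fun i : ULift.{u} (Fin t.1.1) => t.2 i.down) t.1.2
      naturality := ?_ }, ?_⟩⟩
  · intro Z Z' f
    ext t
    exact (map_map_apply G _ f _).symm
  · intro Z
    rw [epi_iff_surjective]
    intro z
    obtain ⟨n, a, f, h⟩ := exists_fin_preimage G z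
    exact ⟨⟨⟨n, a⟩, fun i => f ⟨i⟩⟩, h⟩

end Functors

namespace Presentation

variable {G : Type u ⥤ Type u} (P : Presentation G)

/-- The element of `G Z` presented by the flat term `s(f₀, …, fₙ₋₁)`. -/
def flat {Z : Type u} (s : P.sig.ops) (f : Fin (P.sig.arity s) → Z) : G.obj Z :=
  P.ε.app Z (⟨s, f⟩ : P.sig.poly Z)

theorem map_flat {Z Z' : Type u} (h : Z → Z') (s : P.sig.ops) (f : Fin (P.sig.arity s) → Z) :
    G.map (↾h) (P.flat s f) = P.flat s (h ∘ f) :=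
  (NatTrans.naturality_apply P.ε (↾h) (⟨s, f⟩ : P.sig.poly Z)).symm

theorem exists_flat {Z : Type u} (z : G.obj Z) :
    ∃ (s : P.sig.ops) (f : Fin (P.sig.arity s) → Z), P.flat s f = z := by
  obtain ⟨⟨s, f⟩, h⟩ := (epi_iff_surjective _).1 (P.epi Z) z
  exact ⟨s, f, h⟩

/-! ### The initial algebra -/

/-- The value of a finite tree in a `G`-algebra, every symbol being interpreted via `ε`. -/
def eval (A : Algebra G) : P.sig.FinTree → A.a
  | WType.mk s f => A.str (P.flat s fun i => eval A (f i))

theorem eval_mk (A : Algebra G) (s : P.sig.ops) (f : Fin (P.sig.arity s) → P.sig.FinTree) :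
    P.eval A (PFunctor.W.mk ⟨s, f⟩) = A.str (P.flat s (P.eval A ∘ f)) :=
  rfl

/-- The congruence generated by the `ε`-equations is sound for evaluation in `G`-algebras. -/
theorem Cong.eval_eq {A : Algebra G} {t t' : P.sig.FinTree} (h : P.Cong t t') :
    P.eval A t = P.eval A t' := by
  induction h with
  | eqn a b h θ =>
    obtain ⟨s, f⟩ := a
    obtain ⟨s', f'⟩ := b
    have h' : P.flat s f = P.flat s' f' := h
    change A.str (P.flat s (P.eval A ∘ θ ∘ f)) = A.str (P.flat s' (P.eval A ∘ θ ∘ f'))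
    rw [← Function.comp_assoc, ← Function.comp_assoc, ← map_flat, ← map_flat, h']
  | op s f g _ ih => rw [eval_mk, eval_mk, show P.eval A ∘ f = P.eval A ∘ g from funext ih]
  | refl t => rfl
  | symm _ ih => exact ih.symm
  | trans _ _ ih ih' => exact ih.trans ih'

/-- Two finite trees are identified if they have the same value in every `G`-algebra. -/
def evalSetoid : Setoid P.sig.FinTree where
  r t t' := ∀ A : Algebra G, P.eval A t = P.eval A t'
  iseqv := ⟨fun _ _ => rfl, fun h A => (h A).symm, fun h h' A => (h A).trans (h' A)⟩

/-- The finite trees modulo equality of values, as a `G`-algebra. The structure picks a flat term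
presenting a given element and representatives of its variables; see `quotEval_str`. -/
noncomputable def initialAlgebra : Algebra G where
  a := Quotient P.evalSetoid
  str := ↾fun z => Quotient.mk _
    (PFunctor.W.mk ⟨(P.exists_flat z).choose,
      fun i => ((P.exists_flat z).choose_spec.choose i).out⟩)

/-- The class of a finite tree. -/
def toInitial (t : P.sig.FinTree) : P.initialAlgebra.a :=
  Quotient.mk P.evalSetoid t

theorem exists_toInitial (x : P.initialAlgebra.a) : ∃ t, P.toInitial t = x :=
  Quotient.exists_rep x

/-- Evaluation in a `G`-algebra, on classes of finite trees. -/
def quotEval (A : Algebra G) : P.initialAlgebra.a → A.a :=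
  Quotient.lift (P.eval A) fun _ _ h => h A

theorem quotEval_comp_toInitial (A : Algebra G) : P.quotEval A ∘ P.toInitial = P.eval A :=
  rfl

theorem quotEval_str (A : Algebra G) (z : G.obj P.initialAlgebra.a) :
    P.quotEval A (P.initialAlgebra.str z) = A.str (G.map (↾(P.quotEval A)) z) := by
  have hz := (P.exists_flat z).choose_spec.choose_spec
  conv_rhs => rw [← hz, map_flat]
  refine congrArg A.str (congrArg (P.flat _) (funext fun i => ?_))
  exact congrArg (P.quotEval A) (Quotient.out_eq ((P.exists_flat z).choose_spec.choose i))

theorem toInitial_mk (s : P.sig.ops) (f : Fin (P.sig.arity s) → P.sig.FinTree) :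
    P.toInitial (PFunctor.W.mk ⟨s, f⟩) = P.initialAlgebra.str (P.flat s (P.toInitial ∘ f)) := by
  obtain ⟨t, ht⟩ := P.exists_toInitial (P.initialAlgebra.str (P.flat s (P.toInitial ∘ f)))
  rw [← ht]
  refine Quotient.sound fun A => ?_
  have h := P.quotEval_str A (P.flat s (P.toInitial ∘ f))
  rw [← ht, map_flat, ← Function.comp_assoc, quotEval_comp_toInitial] at h
  exact h.symm

theorem exists_isInitial (P : Presentation G) : ∃ A : Algebra G, Nonempty (IsInitial A) := by
  refine ⟨P.initialAlgebra, ⟨IsInitial.ofUniqueHom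
    (fun A => ⟨↾(P.quotEval A), ?_⟩) fun A h => ?_⟩⟩
  · ext z
    exact (P.quotEval_str A z).symm
  · ext x
    obtain ⟨t, rfl⟩ := P.exists_toInitial x
    induction t with
    | mk s f ih =>
      refine (congrArg h.f (P.toInitial_mk s f)).trans ?_
      refine (ConcreteCategory.congr_hom h.h _).symm.trans ?_
      change A.str (G.map (↾h.f) (P.flat s (P.toInitial ∘ f))) = A.str (P.flat s _)
      rw [map_flat]
      exact congrArg A.str (congrArg (P.flat _) (funext ih))

/-- Induction over an initial algebra: it is generated by the flat terms. -/
theorem initial_induction (P : Presentation G) {A : Algebra G} (hA : IsInitial A) {C : A.a → Prop}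
    (step : ∀ (s : P.sig.ops) (f : Fin (P.sig.arity s) → A.a), (∀ i, C (f i)) →
      C (A.str (P.flat s f))) (t : A.a) : C t := by
  have key (z : G.obj {t // C t}) : C (A.str (G.map (↾Subtype.val) z)) := by
    obtain ⟨s, f, rfl⟩ := P.exists_flat z
    rw [map_flat]
    exact step s _ fun i => (f i).2
  let B : Algebra G := ⟨{t // C t}, ↾fun z => ⟨_, key z⟩⟩
  let j : B ⟶ A := ⟨↾Subtype.val, by ext z; rfl⟩
  have h := ConcreteCategory.congr_hom (congrArg Algebra.Hom.f (hA.hom_ext (hA.to B ≫ j) (𝟙 A))) t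
  have h' : ((hA.to B).f t).1 = t := h
  exact h' ▸ ((hA.to B).f t).2

/-! ### The terminal coalgebra -/

/-- Every coalgebra has a homomorphism into the coalgebra of all trees, since its structure can be
lifted along the surjection `ε`. -/
theorem nonempty_hom_treeCoalgebra (C : Coalgebra G) : Nonempty (C ⟶ P.treeCoalgebra) := by
  choose s f h using fun c : C.V => P.exists_flat (C.str c)
  let g : C.V → P.sig.poly C.V := fun c => ⟨s c, f c⟩
  refine ⟨⟨↾(PFunctor.M.corec g), ?_⟩⟩
  ext c
  change G.map (↾(PFunctor.M.corec g)) (C.str c) =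
    P.ε.app P.sig.Tree (PFunctor.M.dest (PFunctor.M.corec g c))
  rw [PFunctor.M.dest_corec, ← h, map_flat]
  rfl

end Presentation

/-- A relation on a coalgebra is a precongruence if the structure, followed by the quotient map,
identifies related elements. -/
def IsPrecongruence {G : Type u ⥤ Type u} (C : Coalgebra G) (r : C.V → C.V → Prop) : Prop :=
  ∀ a b, r a b → G.map (↾(Quot.mk r)) (C.str a) = G.map (↾(Quot.mk r)) (C.str b)

/-- The union of all precongruences on a coalgebra. -/
def maxPrecongruence {G : Type u ⥤ Type u} (C : Coalgebra G) (a b : C.V) : Prop :=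
  ∃ r, IsPrecongruence C r ∧ r a b

section Coalgebras

variable {G : Type u ⥤ Type u}

theorem isPrecongruence_max (C : Coalgebra G) : IsPrecongruence C (maxPrecongruence C) := by
  rintro a b ⟨r, hr, hab⟩
  let k : Quot r → Quot (maxPrecongruence C) := Quot.map id fun x y hxy => ⟨r, hr, hxy⟩
  have h := congrArg (G.map (↾k)) (hr a b hab)
  rw [map_map_apply, map_map_apply] at h
  exact h

/-- The quotient of a coalgebra by its largest precongruence. -/
def simpleQuotient (C : Coalgebra G) : Coalgebra G where
  V := Quot (maxPrecongruence C)
  str := ↾(Quot.lift (fun c => G.map (↾(Quot.mk (maxPrecongruence C))) (C.str c))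
    (isPrecongruence_max C))

/-- Homomorphisms into the simple quotient are unique: equalizing two of them would give a larger
precongruence. -/
theorem hom_simpleQuotient_ext {C D : Coalgebra G} (f g : D ⟶ simpleQuotient C) : f = g := by
  let q : C.V → (simpleQuotient C).V := Quot.mk (maxPrecongruence C)
  let r : C.V → C.V → Prop := fun a b =>
    maxPrecongruence C a b ∨ ∃ d, q a = f.f d ∧ q b = g.f d
  let k : (simpleQuotient C).V → Quot r := Quot.map id fun _ _ h => Or.inl h
  have hkq : k ∘ q = Quot.mk r := rfl
  have hk : k ∘ f.f = k ∘ g.f := by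
    funext d
    obtain ⟨a, ha⟩ := Quot.exists_rep (f.f d)
    obtain ⟨b, hb⟩ := Quot.exists_rep (g.f d)
    change k (f.f d) = k (g.f d)
    rw [← ha, ← hb]
    exact Quot.sound (Or.inr ⟨d, ha, hb⟩)
  have hstr (c : C.V) :
      G.map (↾(Quot.mk r)) (C.str c) = G.map (↾k) ((simpleQuotient C).str (q c)) := by
    rw [← hkq, ← map_map_apply]
    rfl
  have hr : IsPrecongruence C r := by
    rintro a b (h | ⟨d, ha, hb⟩)
    · rw [hstr, hstr, show q a = q b from Quot.sound h]
    · have hf : G.map (↾f.f) (D.str d) = (simpleQuotient C).str (f.f d) :=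
        ConcreteCategory.congr_hom f.h d
      have hg : G.map (↾g.f) (D.str d) = (simpleQuotient C).str (g.f d) :=
        ConcreteCategory.congr_hom g.h d
      rw [hstr, hstr, ha, hb, ← hf, ← hg, map_map_apply, map_map_apply, hk]
  ext d
  obtain ⟨a, ha⟩ := Quot.exists_rep (f.f d)
  obtain ⟨b, hb⟩ := Quot.exists_rep (g.f d)
  refine ha.symm.trans (Eq.trans ?_ hb)
  exact Quot.sound ⟨r, hr, Or.inr ⟨d, ha, hb⟩⟩

end Coalgebras

theorem Presentation.exists_isTerminal {G : Type u ⥤ Type u} (P : Presentation G) :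
    ∃ C : Coalgebra G, Nonempty (IsTerminal C) := by
  let q : P.treeCoalgebra ⟶ simpleQuotient P.treeCoalgebra :=
    ⟨↾(Quot.mk (maxPrecongruence P.treeCoalgebra)), rfl⟩
  exact ⟨_, ⟨IsTerminal.ofUniqueHom
    (fun C => (P.nonempty_hom_treeCoalgebra C).some ≫ q) fun _ _ => hom_simpleQuotient_ext _ _⟩⟩

/-! ### Separation by cuttings -/

section Coalgebras

variable {G : Type u ⥤ Type u}

/-- Coinduction: on a terminal coalgebra, precongruences only relate equal elements. -/
theorem IsPrecongruence.eq_of_isTerminal {C : Coalgebra G} (hC : IsTerminal C)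
    {r : C.V → C.V → Prop} (hr : IsPrecongruence C r) {a b : C.V} (hab : r a b) : a = b := by
  let D : Coalgebra G := ⟨Quot r, ↾(Quot.lift (fun c => G.map (↾(Quot.mk r)) (C.str c)) hr)⟩
  let q : C ⟶ D := ⟨↾(Quot.mk r), rfl⟩
  have h (c : C.V) : (hC.from D).f (Quot.mk r c) = c :=
    ConcreteCategory.congr_hom (congrArg Coalgebra.Hom.f (hC.hom_ext (q ≫ hC.from D) (𝟙 C))) c
  rw [← h a, ← h b, Quot.sound hab]

theorem terminal_str_injective {C : Coalgebra G} (hC : IsTerminal C) :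
    Function.Injective C.str :=
  Function.LeftInverse.injective (g := Coalgebra.Terminal.strInv hC)
    fun c => ConcreteCategory.congr_hom (Coalgebra.Terminal.right_inv hC) c

theorem terminal_str_strInv {C : Coalgebra G} (hC : IsTerminal C) (z : G.obj C.V) :
    C.str (Coalgebra.Terminal.strInv hC z) = z :=
  ConcreteCategory.congr_hom (Coalgebra.Terminal.left_inv hC) z

theorem initial_strInv_str {A : Algebra G} (hA : IsInitial A) (z : G.obj A.a) :
    Algebra.Initial.strInv hA (A.str z) = z :=
  ConcreteCategory.congr_hom (Algebra.Initial.right_inv hA) z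

end Coalgebras

section Cutting

variable {F : Type u ⥤ Type u} {Y : Type u} {p : Y} {Phi : Algebra (plus F Y)}
  {Psi : Coalgebra (plus F Y)}

theorem str_incl (hPhi : IsInitial Phi) (hPsi : IsTerminal Psi) (z : (plus F Y).obj Phi.a) :
    Psi.str (incl hPhi hPsi (Phi.str z)) = (plus F Y).map (↾(incl hPhi hPsi)) z := by
  have h := ConcreteCategory.congr_hom
    (hPsi.from (⟨Phi.a, Algebra.Initial.strInv hPhi⟩ : Coalgebra (plus F Y))).h (Phi.str z)
  refine h.symm.trans ?_
  exact congrArg ((plus F Y).map (↾(incl hPhi hPsi))) (initial_strInv_str hPhi z)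

theorem cutting_succ (p : Y) (Psi : Coalgebra (plus F Y)) (Phi : Algebra (plus F Y)) (n : ℕ)
    (x : Psi.V) :
    cutting p Psi Phi (n + 1) x =
      Phi.str ((plus F Y).map (↾(cutting p Psi Phi n)) (Psi.str x)) :=
  rfl

theorem cutting_succ_incl_str (hPhi : IsInitial Phi) (hPsi : IsTerminal Psi) (k : ℕ)
    (z : (plus F Y).obj Phi.a) :
    cutting p Psi Phi (k + 1) (incl hPhi hPsi (Phi.str z)) =
      Phi.str ((plus F Y).map (↾(cutting p Psi Phi k ∘ incl hPhi hPsi)) z) := by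
  rw [cutting_succ, str_incl, map_map_apply]

/-- Cutting at height `n` and then at height `k` is cutting at height `min k n`. -/
theorem cutting_incl_cutting (hPhi : IsInitial Phi) (hPsi : IsTerminal Psi) (k n : ℕ) (y : Psi.V) :
    cutting p Psi Phi k (incl hPhi hPsi (cutting p Psi Phi n y)) =
      cutting p Psi Phi (min k n) y := by
  induction k generalizing n y with
  | zero => rw [Nat.zero_min]; rfl
  | succ k ih =>
    cases n with
    | zero => exact cutting_succ_incl_str hPhi hPsi k _
    | succ n =>
      rw [Nat.add_min_add_right, cutting_succ p Psi Phi n, cutting_succ_incl_str, map_map_apply,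
        cutting_succ]
      exact congrArg (fun h => Phi.str ((plus F Y).map (↾h) (Psi.str y))) (funext (ih n))

/-- Elements of the initial algebra have finite height: they are fixed by cutting high enough. -/
theorem exists_forall_cutting_incl (P : Presentation F) (p : Y) (hPhi : IsInitial Phi)
    (hPsi : IsTerminal Psi) (t : Phi.a) :
    ∃ n, ∀ k, n ≤ k → cutting p Psi Phi k (incl hPhi hPsi t) = t := by
  induction t using (P.plus Y).initial_induction hPhi with
  | step s f ih =>
    choose n hn using ih
    refine ⟨Finset.univ.sup n + 1, fun k hk => ?_⟩
    obtain ⟨k, rfl⟩ := Nat.exists_eq_add_of_le' (Nat.le_of_add_left_le hk)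
    rw [cutting_succ_incl_str, Presentation.map_flat]
    refine congrArg Phi.str (congrArg ((P.plus Y).flat s) (funext fun i => ?_))
    exact hn i k ((Finset.le_sup (Finset.mem_univ i)).trans (Nat.le_of_succ_le_succ hk))

theorem incl_injective (P : Presentation F) (p : Y) (hPhi : IsInitial Phi)
    (hPsi : IsTerminal Psi) : Function.Injective (incl hPhi hPsi) := by
  intro t t' h
  obtain ⟨n, hn⟩ := exists_forall_cutting_incl P p hPhi hPsi t
  obtain ⟨n', hn'⟩ := exists_forall_cutting_incl P p hPhi hPsi t'
  rw [← hn _ (le_max_left n n'), ← hn' _ (le_max_right n n'), h]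

theorem cutting_eq_of_le (hPhi : IsInitial Phi) (hPsi : IsTerminal Psi) {k n : ℕ} (hkn : k ≤ n)
    {x y : Psi.V} (h : cutting p Psi Phi n x = cutting p Psi Phi n y) :
    cutting p Psi Phi k x = cutting p Psi Phi k y := by
  have h' := congrArg (fun t => cutting p Psi Phi k (incl hPhi hPsi t)) h
  simpa only [cutting_incl_cutting, min_eq_left hkn] using h'

/-- Elements of the terminal coalgebra with the same cuttings are equal. Having the same cuttings
is a precongruence: modulo this relation, the structures of two related elements involve only
finitely many elements altogether, and these are separated by a single cutting. -/
theorem eq_of_forall_cutting_eq (P : Presentation F) (hPhi : IsInitial Phi)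
    (hPsi : IsTerminal Psi) {x y : Psi.V}
    (h : ∀ n, cutting p Psi Phi n x = cutting p Psi Phi n y) : x = y := by
  let r : Psi.V → Psi.V → Prop := fun a b => ∀ n, cutting p Psi Phi n a = cutting p Psi Phi n b
  refine IsPrecongruence.eq_of_isTerminal hPsi (r := r) ?_ h
  intro a b hab
  let d : ℕ → Quot r → Phi.a := fun n => Quot.lift (cutting p Psi Phi n) fun _ _ h => h n
  have hd (n : ℕ) : d n ∘ Quot.mk r = cutting p Psi Phi n := rfl
  have hsep (u v : Quot r) (huv : u ≠ v) : ∀ᶠ n in Filter.atTop, d n u ≠ d n v := by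
    obtain ⟨u, rfl⟩ := Quot.exists_rep u
    obtain ⟨v, rfl⟩ := Quot.exists_rep v
    obtain ⟨n, hn⟩ := not_forall.1 fun h : r u v => huv (Quot.sound h)
    exact Filter.eventually_atTop.2
      ⟨n, fun k hk he => hn (cutting_eq_of_le hPhi hPsi hk he)⟩
  obtain ⟨s, f, hf⟩ := (P.plus Y).exists_flat ((plus F Y).map (↾(Quot.mk r)) (Psi.str a))
  obtain ⟨s', f', hf'⟩ := (P.plus Y).exists_flat ((plus F Y).map (↾(Quot.mk r)) (Psi.str b))
  let A : Set (Quot r) := Set.range f ∪ Set.range f'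
  have hA : A.Finite := (Set.finite_range f).union (Set.finite_range f')
  obtain ⟨n, hn⟩ : ∃ n, Set.InjOn (d n) A := by
    have h : ∀ᶠ n in Filter.atTop, ∀ u ∈ A, ∀ v ∈ A, u ≠ v → d n u ≠ d n v :=
      (Filter.eventually_all_finite hA).2 fun u _ => (Filter.eventually_all_finite hA).2
        fun v _ => Filter.eventually_imp_distrib_left.2 (hsep u v)
    obtain ⟨n, hn⟩ := h.exists
    exact ⟨n, fun u hu v hv he => not_not.1 fun huv => hn u hu v hv huv he⟩
  -- The image under `F(-) + Y` of a left inverse of `d n` on `A` recovers both structures from their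
  -- images under `d n`; the functor itself need not preserve injective maps.
  have : Nonempty (Quot r) := ⟨Quot.mk r a⟩
  obtain ⟨g, hg⟩ : ∃ g, Set.LeftInvOn g (d n) A := ⟨_, hn.leftInvOn_invFunOn⟩
  have hgf : (g ∘ d n) ∘ f = f := funext fun i => hg (Or.inl ⟨i, rfl⟩)
  have hgf' : (g ∘ d n) ∘ f' = f' := funext fun i => hg (Or.inr ⟨i, rfl⟩)
  have hab' : (plus F Y).map (↾(cutting p Psi Phi n)) (Psi.str a) =
      (plus F Y).map (↾(cutting p Psi Phi n)) (Psi.str b) := by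
    rw [← initial_strInv_str hPhi ((plus F Y).map _ (Psi.str a)),
      ← initial_strInv_str hPhi ((plus F Y).map _ (Psi.str b))]
    exact congrArg _ (hab (n + 1))
  have ha : (plus F Y).map (↾g) ((plus F Y).map (↾(cutting p Psi Phi n)) (Psi.str a)) =
      (plus F Y).map (↾(Quot.mk r)) (Psi.str a) := by
    rw [← hd n, ← map_map_apply _ (Quot.mk r) (d n), ← hf, map_map_apply, Presentation.map_flat, hgf]
  have hb : (plus F Y).map (↾g) ((plus F Y).map (↾(cutting p Psi Phi n)) (Psi.str b)) =
      (plus F Y).map (↾(Quot.mk r)) (Psi.str b) := by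
    rw [← hd n, ← map_map_apply _ (Quot.mk r) (d n), ← hf', map_map_apply, Presentation.map_flat, hgf']
  exact ha.symm.trans ((congrArg _ hab').trans hb)

/-! ### The order by cutting in terms of cuttings -/

theorem str_classOf (P : Presentation F) (hPsi : IsTerminal Psi) (t : (P.plus Y).sig.Tree) :
    Psi.str ((P.plus Y).classOf hPsi t) =
      (P.plus Y).flat t.head ((P.plus Y).classOf hPsi ∘ t.children) := by
  refine (ConcreteCategory.congr_hom (hPsi.from (P.plus Y).treeCoalgebra).h t).symm.trans ?_
  exact (P.plus Y).map_flat ((P.plus Y).classOf hPsi) t.head t.children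

theorem str_classOf_mk (P : Presentation F) (hPsi : IsTerminal Psi) (s : (P.plus Y).sig.ops)
    (f : Fin ((P.plus Y).sig.arity s) → (P.plus Y).sig.Tree) :
    Psi.str ((P.plus Y).classOf hPsi (PFunctor.M.mk ⟨s, f⟩)) =
      (P.plus Y).flat s ((P.plus Y).classOf hPsi ∘ f) := by
  refine (ConcreteCategory.congr_hom
    (hPsi.from (P.plus Y).treeCoalgebra).h (PFunctor.M.mk ⟨s, f⟩)).symm.trans ?_
  exact (P.plus Y).map_flat ((P.plus Y).classOf hPsi) s f

theorem classOf_surjective (P : Presentation F) (hPsi : IsTerminal Psi) :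
    Function.Surjective ((P.plus Y).classOf hPsi) := by
  intro x
  obtain ⟨h⟩ := (P.plus Y).nonempty_hom_treeCoalgebra Psi
  exact ⟨h.f x, ConcreteCategory.congr_hom
    (congrArg Coalgebra.Hom.f (hPsi.hom_ext (h ≫ hPsi.from _) (𝟙 Psi))) x⟩

theorem eval_cut (P : Presentation F) (hPsi : IsTerminal Psi) (n : ℕ)
    (t : (P.plus Y).sig.Tree) :
    (P.plus Y).eval Phi (Signature.cut (Sum.inr p : P.sig.ops ⊕ Y) rfl n t) =
      cutting p Psi Phi n ((P.plus Y).classOf hPsi t) := by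
  induction n generalizing t with
  | zero => rfl
  | succ n ih =>
    rw [cutting_succ, str_classOf, Presentation.map_flat]
    exact congrArg Phi.str (congrArg ((P.plus Y).flat _) (funext fun i => ih _))

theorem classOf_toTree (P : Presentation F) (hPhi : IsInitial Phi) (hPsi : IsTerminal Psi)
    (t : (P.plus Y).sig.FinTree) :
    (P.plus Y).classOf hPsi (Signature.FinTree.toTree t) =
      incl hPhi hPsi ((P.plus Y).eval Phi t) := by
  induction t with
  | mk s f ih =>
    apply terminal_str_injective hPsi
    refine (str_classOf_mk P hPsi s _).trans ?_
    refine Eq.trans ?_ (str_incl hPhi hPsi ((P.plus Y).flat s _)).symm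
    rw [Presentation.map_flat]
    exact congrArg ((P.plus Y).flat s) (funext ih)

/-- The order by cutting, freed from trees: `x ⊑ y` iff `x` is `y` or one of its cuttings. Only the
soundness of the congruence on finite trees enters, as the cuttings of an element determine it. -/
theorem psiLE_iff (P : Presentation F) (hPhi : IsInitial Phi) (hPsi : IsTerminal Psi)
    {x y : Psi.V} :
    psiLE P p hPsi x y ↔ x = y ∨ ∃ n, x = incl hPhi hPsi (cutting p Psi Phi n y) := by
  refine or_congr_right ⟨?_, ?_⟩
  · rintro ⟨s, s', rfl, rfl, n, h⟩
    refine ⟨n, eq_of_forall_cutting_eq P hPhi hPsi (p := p) fun k => ?_⟩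
    rw [← eval_cut P hPsi n, ← classOf_toTree P hPhi hPsi, ← eval_cut, ← eval_cut]
    exact (h k).eval_eq
  · rintro ⟨n, rfl⟩
    obtain ⟨s, rfl⟩ := classOf_surjective P hPsi y
    refine ⟨Signature.FinTree.toTree (Signature.cut (Sum.inr p : P.sig.ops ⊕ Y) rfl n s), s, ?_,
      rfl, n, fun _ => .refl _⟩
    rw [classOf_toTree P hPhi hPsi, eval_cut]

/-- The order by cutting as a partial order. -/
abbrev psiOrder (P : Presentation F) (p : Y) (hPhi : IsInitial Phi) (hPsi : IsTerminal Psi) :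
    PartialOrder Psi.V where
  le := psiLE P p hPsi
  le_refl x := Or.inl rfl
  le_trans x y z hxy hyz := by
    rw [psiLE_iff P hPhi hPsi] at *
    rcases hxy with rfl | ⟨k, rfl⟩
    · exact hyz
    rcases hyz with rfl | ⟨n, rfl⟩
    · exact Or.inr ⟨k, rfl⟩
    · exact Or.inr ⟨min k n, by rw [cutting_incl_cutting]⟩
  le_antisymm x y hxy hyx := by
    rw [psiLE_iff P hPhi hPsi] at *
    rcases hxy with h | ⟨k, hx⟩
    · exact h
    rcases hyx with h | ⟨n, hy⟩
    · exact h.symm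
    rcases le_total k n with hkn | hnk
    · have hy' : y = incl hPhi hPsi (cutting p Psi Phi n (incl hPhi hPsi (cutting p Psi Phi k y))) :=
        hx ▸ hy
      rw [cutting_incl_cutting, min_eq_right hkn] at hy'
      exact hx.trans hy'.symm
    · have hx' : x = incl hPhi hPsi (cutting p Psi Phi k (incl hPhi hPsi (cutting p Psi Phi n x))) :=
        hy ▸ hx
      rw [cutting_incl_cutting, min_eq_right hnk] at hx'
      exact hx'.trans hy.symm

/-- If every cutting of `y` is below `u` in the order by cutting, then so is `y`. -/
theorem psiLE_of_forall_cutting (P : Presentation F) (hPhi : IsInitial Phi)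
    (hPsi : IsTerminal Psi) {y u : Psi.V}
    (h : ∀ k, psiLE P p hPsi (incl hPhi hPsi (cutting p Psi Phi k y)) u) :
    psiLE P p hPsi y u := by
  have h' (k : ℕ) : ∃ n, cutting p Psi Phi k y = cutting p Psi Phi n u := by
    rcases (psiLE_iff P hPhi hPsi).1 (h k) with rfl | ⟨n, hn⟩
    · exact ⟨k, by rw [cutting_incl_cutting, min_self]⟩
    · exact ⟨n, incl_injective P p hPhi hPsi hn⟩
  rw [psiLE_iff P hPhi hPsi]
  by_cases hfreq : ∃ n, ∃ᶠ k in Filter.atTop, cutting p Psi Phi k y = cutting p Psi Phi n u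
  · -- A single cutting of `u` agrees with arbitrarily high cuttings of `y`, hence equals `y`.
    obtain ⟨n, hn⟩ := hfreq
    refine Or.inr ⟨n, eq_of_forall_cutting_eq P hPhi hPsi (p := p) fun j => ?_⟩
    obtain ⟨k, hjk, hk⟩ := Filter.frequently_atTop.1 hn j
    rw [← hk, cutting_incl_cutting, min_eq_left hjk]
  · -- High cuttings of `y` are high cuttings of `u`, so that `y` and `u` have the same cuttings.
    refine Or.inl (eq_of_forall_cutting_eq P hPhi hPsi (p := p) fun j => ?_)
    have hev : ∀ᶠ k in Filter.atTop, ∀ n ∈ Set.Iio j,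
        cutting p Psi Phi k y ≠ cutting p Psi Phi n u :=
      (Filter.eventually_all_finite (Set.finite_Iio j)).2 fun n _ =>
        Filter.not_frequently.1 fun hn => hfreq ⟨n, hn⟩
    obtain ⟨k, hk, hjk⟩ := (hev.and (Filter.eventually_ge_atTop j)).exists
    obtain ⟨n, hn⟩ := h' k
    have hjn : j ≤ n := not_lt.1 fun hnj => hk n hnj hn
    have hcut := congrArg (fun t => cutting p Psi Phi j (incl hPhi hPsi t)) hn
    simpa only [cutting_incl_cutting, min_eq_left hjk, min_eq_left hjn] using hcut

/-! ### Solutions of recursive equations -/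

variable {X : Type u} {e : X → F.obj X ⊕ Psi.V}

theorem isSolution_iff (hPsi : IsTerminal Psi) {s : X → Psi.V} :
    IsSolution (psiAlgebra hPsi) e s ↔
      ∀ x, Psi.str (s x) = Sum.elim (fun z => Sum.inl (F.map (↾s) z)) Psi.str (e x) := by
  refine forall_congr' fun x => ?_
  rw [← (terminal_str_injective hPsi).eq_iff]
  cases e x with
  | inl z =>
    have h := terminal_str_strInv hPsi (Sum.inl (F.map (↾s) z) : F.obj Psi.V ⊕ Y)
    exact ⟨fun hs => hs.trans h, fun hs => hs.trans h.symm⟩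
  | inr y => exact Iff.rfl

/-- The coalgebra on `X + ΨY` that follows the equation `e` on `X` and the structure of `ΨY` on
`ΨY`. -/
def equationCoalgebra (e : X → F.obj X ⊕ Psi.V) : Coalgebra (plus F Y) where
  V := X ⊕ Psi.V
  str := ↾(Sum.elim
    (fun x => Sum.elim
      (fun z => (Sum.inl (F.map (↾(Sum.inl : X → X ⊕ Psi.V)) z) : F.obj (X ⊕ Psi.V) ⊕ Y))
      (fun y => (plus F Y).map (↾(Sum.inr : Psi.V → X ⊕ Psi.V)) (Psi.str y)) (e x))
    fun y => (plus F Y).map (↾(Sum.inr : Psi.V → X ⊕ Psi.V)) (Psi.str y))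

theorem exists_isSolution (hPsi : IsTerminal Psi) (e : X → F.obj X ⊕ Psi.V) :
    ∃ s, IsSolution (psiAlgebra hPsi) e s := by
  let h := hPsi.from (equationCoalgebra e)
  let j : Psi ⟶ equationCoalgebra e := ⟨↾Sum.inr, rfl⟩
  let g : X ⊕ Psi.V → Psi.V := h.f
  have hinr : g ∘ Sum.inr = id := funext fun y => ConcreteCategory.congr_hom
    (congrArg Coalgebra.Hom.f (hPsi.hom_ext (j ≫ h) (𝟙 Psi))) y
  refine ⟨g ∘ Sum.inl, (isSolution_iff hPsi).2 fun x => ?_⟩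
  refine (ConcreteCategory.congr_hom h.h (Sum.inl x : X ⊕ Psi.V)).symm.trans ?_
  change (plus F Y).map (↾g) (Sum.elim _ _ (e x)) = _
  cases e x with
  | inl z => exact congrArg Sum.inl (map_map_apply F Sum.inl g z)
  | inr y =>
    refine (map_map_apply (plus F Y) Sum.inr g (Psi.str y)).trans ?_
    rw [hinr]
    exact map_id_apply _ _

theorem IsSolution.unique {hPsi : IsTerminal Psi} {s s' : X → Psi.V}
    (hs : IsSolution (psiAlgebra hPsi) e s) (hs' : IsSolution (psiAlgebra hPsi) e s') : s = s' := by
  have key (t : X → Psi.V) (ht : IsSolution (psiAlgebra hPsi) e t) :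
      t = (hPsi.from (equationCoalgebra e)).f ∘ Sum.inl := by
    let k : equationCoalgebra e ⟶ Psi := ⟨↾(Sum.elim t id), by
      ext (x | y)
      · change (plus F Y).map (↾(Sum.elim t id)) (Sum.elim _ _ (e x)) = Psi.str (t x)
        rw [(isSolution_iff hPsi).1 ht x]
        cases e x with
        | inl z => exact congrArg Sum.inl (map_map_apply F Sum.inl (Sum.elim t id) z)
        | inr y =>
          refine (map_map_apply (plus F Y) Sum.inr (Sum.elim t id) (Psi.str y)).trans ?_
          exact map_id_apply _ _
      · refine (map_map_apply (plus F Y) Sum.inr (Sum.elim t id) (Psi.str y)).trans ?_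
        exact map_id_apply _ _⟩
    exact funext fun x => ConcreteCategory.congr_hom
      (congrArg Coalgebra.Hom.f (hPsi.hom_ext k (hPsi.from _))) (Sum.inl x : X ⊕ Psi.V)
  rw [key s hs, key s' hs']

/-- The approximate solutions are the cuttings of the solution. -/
theorem IsSolution.approx_eq {hPsi : IsTerminal Psi} {s : X → Psi.V}
    (hs : IsSolution (psiAlgebra hPsi) e s) (p : Y) (Phi : Algebra (plus F Y)) (k : ℕ) :
    approx p Psi Phi e k = cutting p Psi Phi k ∘ s := by
  induction k with
  | zero => rfl
  | succ k ih =>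
    funext x
    rw [approx, ih, Function.comp_apply, cutting_succ, (isSolution_iff hPsi).1 hs x]
    cases e x with
    | inl z =>
      exact congrArg (phiAlgebra Phi).str (map_map_apply F s (cutting p Psi Phi k) z).symm
    | inr y => rfl

end Cutting

end FreeCIA

theorem corollaryC (F : Type u ⥤ Type u) [PreservesFilteredColimits F] (Y : Type u) (p : Y) :
    Nonempty (FreeCIA.Presentation F) ∧
    (∃ Phi : Algebra (FreeCIA.plus F Y), Nonempty (IsInitial Phi)) ∧
    (∃ Psi : Coalgebra (FreeCIA.plus F Y), Nonempty (IsTerminal Psi)) ∧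
    ∀ (P : FreeCIA.Presentation F)
      (Phi : Algebra (FreeCIA.plus F Y)) (hPhi : IsInitial Phi)
      (Psi : Coalgebra (FreeCIA.plus F Y)) (hPsi : IsTerminal Psi),
      ∃ O : PartialOrder Psi.V,
        (∀ x y : Psi.V, x ≤ y ↔ FreeCIA.psiLE P p hPsi x y) ∧
        Function.Injective (FreeCIA.incl hPhi hPsi) ∧
        ∀ (X : Type u) (e : X → F.obj X ⊕ Psi.V),
          (∀ b : X → Phi.a,
            FreeCIA.incl hPhi hPsi ∘ FreeCIA.approx p Psi Phi e 0 ≤ FreeCIA.incl hPhi hPsi ∘ b) ∧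
          Monotone (fun k : ℕ => FreeCIA.incl hPhi hPsi ∘ FreeCIA.approx p Psi Phi e k) ∧
          ∃ s : X → Psi.V,
            FreeCIA.IsSolution (FreeCIA.psiAlgebra hPsi) e s ∧
            (∀ s' : X → Psi.V, FreeCIA.IsSolution (FreeCIA.psiAlgebra hPsi) e s' → s' = s) ∧
            IsLUB (Set.range
              (fun k : ℕ => FreeCIA.incl hPhi hPsi ∘ FreeCIA.approx p Psi Phi e k)) s := by
  obtain ⟨P₀⟩ := FreeCIA.nonempty_presentation F
  refine ⟨⟨P₀⟩, (P₀.plus Y).exists_isInitial, (P₀.plus Y).exists_isTerminal,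
    fun P Phi hPhi Psi hPsi => ⟨FreeCIA.psiOrder P p hPhi hPsi, fun x y => Iff.rfl,
      FreeCIA.incl_injective P p hPhi hPsi, fun X e => ?_⟩⟩
  obtain ⟨s, hs⟩ := FreeCIA.exists_isSolution hPsi e
  refine ⟨fun b x => ?_, fun k n hkn x => ?_, s, hs, fun s' hs' => hs'.unique hs, ?_, ?_⟩
  · exact (FreeCIA.psiLE_iff P hPhi hPsi).2 (Or.inr ⟨0, rfl⟩)
  · refine (FreeCIA.psiLE_iff P hPhi hPsi).2 (Or.inr ⟨k, ?_⟩)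
    simp only [Function.comp_apply, hs.approx_eq, FreeCIA.cutting_incl_cutting, min_eq_left hkn]
  · rintro _ ⟨k, rfl⟩ x
    exact (FreeCIA.psiLE_iff P hPhi hPsi).2
      (Or.inr ⟨k, congrArg (FreeCIA.incl hPhi hPsi) (congrFun (hs.approx_eq p Phi k) x)⟩)
  · intro u hu x
    refine FreeCIA.psiLE_of_forall_cutting P hPhi hPsi fun k => ?_
    have h := hu ⟨k, rfl⟩ x
    simp only [Function.comp_apply, hs.approx_eq] at h
    exact h
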